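/- Let $\mathcal G$ be a causal structure: a directed acyclic graph with finitely many vertices, partitioned into visible vertices $\mathcal V$ and latent vertices $\mathcal L$, in which latent vertices have no parents; let $L=|\mathcal L|$. Each $v\in\mathcal V$ has a given finite non-empty sample space $\Omega_v$, and $\Omega_{\mathcal V}=\prod_v\Omega_v$. A functional causal model with latent cardinalities $k=(k_\ell)_{\ell\in\mathcal L}$ consists of a set $\Omega_\ell$ of size $k_\ell$ and a probability distribution $P_\ell$ on $\Omega_\ell$ for each $\ell\in\mathcal L$, and of a function $f_v$ from the valuations of the parents of $v$ to $\Omega_v$ for each $v\in\mathcal V$. It generates the distribution $$P_{\mathcal V}(x)=\sum_{\lambda\in\prod_\ell\Omega_\ell}\ \prod_{\ell\in\mathcal L}P_\ell(\lambda_\ell)\prod_{v\in\mathcal V}\delta\bigl(x_v,f_v(x_{\mathrm{vpa}(v)},\lambda_{\mathrm{lpa}(v)})\bigr),\qquad x\in\Omega_{\mathcal V},$$ where $\mathrm{vpa}(v)$ and $\mathrm{lpa}(v)$ are the visible and the latent parents of $v$. Let $\mathcal M(\mathcal G)$ (the compatible distributions) be the set of all distributions generated by functional causal models with arbitrary finite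 latent cardinalities, and $\mathcal U^{(k)}(\mathcal G)$ the set of those generated by models with latent cardinalities $k$ in which every $P_\ell$ is uniform. Put $\Delta(P,Q)=\sum_x|P(x)-Q(x)|$. Call $c=(c_\ell)_{\ell\in\mathcal L}$ a latent cardinality bound if every $P\in\mathcal M(\mathcal G)$ is generated by a functional causal model with latent cardinalities $k_\ell\le c_\ell$. Such bounds exist; for instance, $c_\ell=|\Omega_{\mathcal V}|$ for all $\ell$ is one. Let $c$ be any latent cardinality bound (for example a smallest one), put $C=\max_\ell c_\ell$ (with $C=0$ if $\mathcal L=\emptyset$), and $$\varepsilon(K)=\sum_{n=1}^{L}\frac1{n!}\Bigl(\frac{L(C-1)}{K}\Bigr)^n .$$ For $K\ge1$ and cardinalities $k$ with $k_\ell\ge K$ for all $\ell$ (in particular $K=\min_\ell k_\ell$), a probability distribution $P$ on $\Omega_{\mathcal V}$ passes the test of order $K$ with cardinalities $k$ if there is $\tilde P\in\mathcal U^{(k)}(\mathcal G)$ with $\Delta(P,\tilde P)\le\varepsilon(K)$. Then: 1. $\varepsilon(K)\in\mathcal O(LC/K)$; precisely, $\varepsilon(K)\le 2LC/K$ whenever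 $K\ge 1$ and $K\ge LC$. Moreover $\varepsilon(K)\to0$ as $K\to\infty$, and $\varepsilon(K)$ is non-increasing in $K\ge1$. 2. If $P\in\mathcal M(\mathcal G)$, then $P$ passes the test of every order $K\ge1$ with all cardinalities $k_\ell\ge K$. 3. If $P\notin\mathcal M(\mathcal G)$, then there is a finite $K_0\ge1$ such that $P$ fails the test of every order $K\ge K_0$ with all cardinalities $k_\ell\ge K$. 4. Hence $P\in\mathcal M(\mathcal G)$ if and only if for every $K\ge1$ there are cardinalities $k_\ell\ge K$ with which $P$ passes the test of order $K$. 5. For all cardinalities $k$ with $k_\ell\ge1$, the set $\mathcal U^{(k)}(\mathcal G)$ is finite, and there is a functional causal model with uniform latents of cardinalities $k$ whose distribution $\tilde P$ minimizes $\Delta(P,\cdot)$ over $\mathcal U^{(k)}(\mathcal G)$; for every $K\ge1$ with $K\le k_\ell$ for all $\ell$, $P$ passes the test of order $K$ with cardinalities $k$ if and only if $\Delta(P,\tilde P)\le\varepsilon(K)$. -/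

import Mathlib

open scoped Nat Topology

/-- A causal structure with visible vertices `V` and latent vertices `L`, in standard form: a
directed acyclic graph on `V ⊕ L` in which the latent vertices are exogenous (have no parents). -/
structure CausalStructure (V L : Type*) where
  /-- `Edge q u` is the edge `q → u`. -/
  Edge : V ⊕ L → V ⊕ L → Prop
  acyclic : ∀ q, ¬ Relation.TransGen Edge q q
  exogenous : ∀ q ℓ, ¬ Edge q (Sum.inr ℓ)

namespace CausalStructure

/-- The visible parents of a visible vertex. -/
abbrev VPa {V L : Type*} (G : CausalStructure V L) (v : V) : Type _ :=
  {u : V // G.Edge (Sum.inl u) (Sum.inl v)}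

/-- The latent parents of a visible vertex. -/
abbrev LPa {V L : Type*} (G : CausalStructure V L) (v : V) : Type _ :=
  {ℓ : L // G.Edge (Sum.inr ℓ) (Sum.inl v)}

end CausalStructure

/-- A (finite) functional causal model for `G`, with visible sample spaces `Ω v` and latent sample
spaces `{0, …, k ℓ - 1}`: a deterministic function of the visible and latent parents for every
visible vertex, and a probability distribution for every latent vertex. -/
structure FunctionalModel {V L : Type*} (G : CausalStructure V L) (Ω : V → Type*) (k : L → ℕ) where
  f : ∀ v : V, (∀ u : G.VPa v, Ω u.1) → (∀ ℓ : G.LPa v, Fin (k ℓ.1)) → Ω v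
  p : ∀ ℓ : L, Fin (k ℓ) → ℝ
  p_mem : ∀ ℓ, p ℓ ∈ stdSimplex ℝ (Fin (k ℓ))

namespace FunctionalModel

/-- The distribution on visible valuations generated by a functional causal model:
`P(x) = ∑_λ ∏_ℓ p_ℓ(λ_ℓ) ∏_v δ(x_v, f_v(x_{vpa(v)}, λ_{lpa(v)}))`. -/
def dist {V L : Type*} [Fintype V] [Fintype L] [DecidableEq L] {Ω : V → Type*}
    [∀ v, DecidableEq (Ω v)] {G : CausalStructure V L} {k : L → ℕ}
    (M : FunctionalModel G Ω k) (x : ∀ v, Ω v) : ℝ :=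
  ∑ lam : (∀ ℓ : L, Fin (k ℓ)), (∏ ℓ, M.p ℓ (lam ℓ)) *
    ∏ v, (if x v = M.f v (fun u => x u.1) (fun ℓ => lam ℓ.1) then 1 else 0)

/-- All latent variables are uniformly distributed. -/
def IsUniform {V L : Type*} {Ω : V → Type*} {G : CausalStructure V L} {k : L → ℕ}
    (M : FunctionalModel G Ω k) : Prop :=
  ∀ ℓ i, M.p ℓ i = 1 / (k ℓ : ℝ)

end FunctionalModel

namespace CausalStructure

/-- The set of distributions compatible with `G`: those generated by some functional causal
model, with arbitrary finite latent cardinalities. -/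
def compatible {V L : Type*} [Fintype V] [Fintype L] [DecidableEq L]
    (G : CausalStructure V L) (Ω : V → Type*) [∀ v, DecidableEq (Ω v)] :
    Set ((∀ v, Ω v) → ℝ) :=
  {P | ∃ (k : L → ℕ) (M : FunctionalModel G Ω k), M.dist = P}

/-- The uniformly induced distributions with latent cardinalities `k`. -/
def uniformlyInduced {V L : Type*} [Fintype V] [Fintype L] [DecidableEq L]
    (G : CausalStructure V L) (Ω : V → Type*) [∀ v, DecidableEq (Ω v)] (k : L → ℕ) :
    Set ((∀ v, Ω v) → ℝ) :=
  {P | ∃ M : FunctionalModel G Ω k, M.IsUniform ∧ M.dist = P}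

/-- `c` bounds the latent cardinalities needed for `G`: every compatible distribution is generated
by a functional causal model whose latent variable `ℓ` has cardinality at most `c ℓ`. -/
def IsLatentBound {V L : Type*} [Fintype V] [Fintype L] [DecidableEq L]
    (G : CausalStructure V L) (Ω : V → Type*) [∀ v, DecidableEq (Ω v)] (c : L → ℕ) : Prop :=
  ∀ P ∈ G.compatible Ω,
    ∃ k : L → ℕ, (∀ ℓ, k ℓ ≤ c ℓ) ∧ ∃ M : FunctionalModel G Ω k, M.dist = P

end CausalStructure

/-- The distance `Δ(P, Q) = ∑_x |P(x) - Q(x)|`. -/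
def distrDist {X : Type*} [Fintype X] (P Q : X → ℝ) : ℝ := ∑ x, |P x - Q x|

/-- `∑_{n=1}^{L} (1/n!) (L(C-1)/K)^n`. -/
noncomputable def errorBound (L C K : ℕ) : ℝ :=
  ∑ n ∈ Finset.Icc 1 L, (1 / (n ! : ℝ)) * ((L : ℝ) * ((C : ℝ) - 1) / (K : ℝ)) ^ n

/-- The error `ε(K)` of the test of order `K`, with `L` the number of latent variables and
`C = max_ℓ c ℓ`. -/
noncomputable def testError {L : Type*} [Fintype L] (c : L → ℕ) (K : ℕ) : ℝ :=
  errorBound (Fintype.card L) (Finset.univ.sup c) K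

/-- `P` passes the causal compatibility test of order `K` with latent cardinalities `k`: some
uniformly induced distribution with latent cardinalities `k` is within `ε(K)` of `P`.
It is used with `K ≤ k ℓ` for all `ℓ`, the main case being `K = min_ℓ k ℓ`. -/
def PassesTest {V L : Type*} [Fintype V] [DecidableEq V] [Fintype L] [DecidableEq L]
    (G : CausalStructure V L) {Ω : V → Type*} [∀ v, Fintype (Ω v)] [∀ v, DecidableEq (Ω v)]
    (c : L → ℕ) (K : ℕ) (k : L → ℕ) (P : (∀ v, Ω v) → ℝ) : Prop :=
  ∃ Q ∈ G.uniformlyInduced Ω k, distrDist P Q ≤ testError c K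

/-! By acyclicity each latent valuation forces one visible valuation, so a model's distribution is a
mixture of point masses under a product of latent distributions, linear in each factor. Soundness:
rounding cumulative sums approximates a distribution on `d` points, up to `(d - 1) / k` in `ℓ¹`, by
a pushforward of the uniform distribution on `k` points. Absorbing the pushforward maps into the
functions `f` gives a uniform model, and errors add over the latents (`sum_abs_prod_sub_prod_le`).
The total is at most `L(C-1)/K`, the term `n = 1` of `ε(K)`. Completeness: a latent bound makes the
compatible set a finite union of continuous images of products of simplices, hence closed. An
incompatible `P` is therefore at positive distance from every uniformly induced distribution, while
`ε(K) → 0`. The bound `|Ω_V|` comes from Carathéodory's theorem applied to one latent at a time. -/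

/-- The mixture of the functions `h lam` where the coordinates of `lam` are drawn independently
with weights `p ℓ`. -/
def mixture {L X : Type*} [Fintype L] [DecidableEq L] {κ : L → Type*} [∀ ℓ, Fintype (κ ℓ)]
    (p : ∀ ℓ, κ ℓ → ℝ) (h : (∀ ℓ, κ ℓ) → X → ℝ) (x : X) : ℝ :=
  ∑ lam : (∀ ℓ, κ ℓ), (∏ ℓ, p ℓ (lam ℓ)) * h lam x

/-! ### Mixtures over product distributions -/

section Mixture

variable {L X : Type*} [Fintype L] [DecidableEq L] {κ : L → Type*} [∀ ℓ, Fintype (κ ℓ)]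

theorem prod_update_apply {κ : L → Type*} (p : ∀ ℓ, κ ℓ → ℝ) (a : L) (w : κ a → ℝ) (lam : ∀ ℓ, κ ℓ) :
    ∏ ℓ, Function.update p a w ℓ (lam ℓ) =
      w (lam a) * ∏ ℓ ∈ Finset.univ.erase a, p ℓ (lam ℓ) := by
  rw [← Finset.mul_prod_erase _ _ (Finset.mem_univ a), Function.update_self]
  congr 1
  refine Finset.prod_congr rfl fun ℓ hℓ => ?_
  rw [Function.update_of_ne (Finset.ne_of_mem_erase hℓ)]

theorem sum_prod_eq_one {p : ∀ ℓ, κ ℓ → ℝ} (hp : ∀ ℓ, p ℓ ∈ stdSimplex ℝ (κ ℓ)) :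
    ∑ lam : (∀ ℓ, κ ℓ), ∏ ℓ, p ℓ (lam ℓ) = 1 := by
  rw [← Fintype.prod_sum]
  exact Finset.prod_eq_one fun ℓ _ => (hp ℓ).2

theorem mixture_mem_stdSimplex [Fintype X] {p : ∀ ℓ, κ ℓ → ℝ} {h : (∀ ℓ, κ ℓ) → X → ℝ}
    (hp : ∀ ℓ, p ℓ ∈ stdSimplex ℝ (κ ℓ)) (hh : ∀ lam, h lam ∈ stdSimplex ℝ X) :
    mixture p h ∈ stdSimplex ℝ X := by
  refine ⟨fun x => Finset.sum_nonneg fun lam _ =>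
    mul_nonneg (Finset.prod_nonneg fun ℓ _ => (hp ℓ).1 _) ((hh lam).1 x), ?_⟩
  simp only [mixture]
  rw [Finset.sum_comm]
  simp only [← Finset.mul_sum, (hh _).2, mul_one]
  exact sum_prod_eq_one hp

/-- Linearity in one factor: this exhibits the mixture as a convex combination to which
Carathéodory's theorem applies. -/
theorem mixture_update [∀ ℓ, DecidableEq (κ ℓ)] (p : ∀ ℓ, κ ℓ → ℝ) (h : (∀ ℓ, κ ℓ) → X → ℝ)
    (a : L) (w : κ a → ℝ) :
    mixture (Function.update p a w) h =
      ∑ i, w i • mixture (Function.update p a (Pi.single i 1)) h := by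
  funext x
  simp only [mixture, prod_update_apply, Finset.sum_apply, Pi.smul_apply, smul_eq_mul,
    Finset.mul_sum]
  rw [Finset.sum_comm]
  refine Finset.sum_congr rfl fun lam _ => ?_
  rw [Finset.sum_eq_single (lam a)]
  · simp [mul_assoc]
  · intro i _ hi
    simp [Pi.single_eq_of_ne (Ne.symm hi)]
  · simp

/-- Reindexing the coordinates along maps `g ℓ` amounts to pushing the weights forward. -/
theorem mixture_comp {κ' : L → Type*} [∀ ℓ, Fintype (κ' ℓ)] [∀ ℓ, DecidableEq (κ ℓ)]
    (g : ∀ ℓ, κ' ℓ → κ ℓ) (p' : ∀ ℓ, κ' ℓ → ℝ) (h : (∀ ℓ, κ ℓ) → X → ℝ) :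
    mixture p' (fun lam' => h fun ℓ => g ℓ (lam' ℓ)) =
      mixture (fun ℓ i => ∑ j with g ℓ j = i, p' ℓ j) h := by
  funext x
  simp only [mixture]
  rw [← Finset.sum_fiberwise_of_maps_to (s := Finset.univ) (t := Finset.univ)
    (g := fun lam' : (∀ ℓ, κ' ℓ) => fun ℓ => g ℓ (lam' ℓ)) (fun _ _ => Finset.mem_univ _)]
  refine Finset.sum_congr rfl fun lam _ => ?_
  rw [Finset.prod_univ_sum, Finset.sum_mul]
  refine Finset.sum_congr ?_ fun lam' hlam' => ?_
  · ext lam'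
    simp [Fintype.mem_piFinset, funext_iff]
  · have : ∀ ℓ, g ℓ (lam' ℓ) = lam ℓ := by simpa [Fintype.mem_piFinset] using hlam'
    rw [funext this]

theorem sum_abs_prod_sub_prod_update {r : ∀ ℓ, κ ℓ → ℝ}
    (hr : ∀ ℓ, r ℓ ∈ stdSimplex ℝ (κ ℓ)) (a : L) (w : κ a → ℝ) :
    ∑ lam : (∀ ℓ, κ ℓ), |∏ ℓ, r ℓ (lam ℓ) - ∏ ℓ, Function.update r a w ℓ (lam ℓ)| =
      ∑ i, |r a i - w i| := by
  have h1 : ∀ lam : (∀ ℓ, κ ℓ),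
      |∏ ℓ, r ℓ (lam ℓ) - ∏ ℓ, Function.update r a w ℓ (lam ℓ)| =
        ∏ ℓ, Function.update r a (fun i => |r a i - w i|) ℓ (lam ℓ) := by
    intro lam
    rw [prod_update_apply, prod_update_apply,
      ← Finset.mul_prod_erase _ (fun ℓ => r ℓ (lam ℓ)) (Finset.mem_univ a), ← sub_mul, abs_mul]
    congr 1
    exact abs_of_nonneg (Finset.prod_nonneg fun ℓ _ => (hr ℓ).1 _)
  simp only [h1]
  rw [← Fintype.prod_sum, ← Finset.mul_prod_erase _ _ (Finset.mem_univ a),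
    Function.update_self, Finset.prod_eq_one, mul_one]
  intro ℓ hℓ
  rw [Function.update_of_ne (Finset.ne_of_mem_erase hℓ)]
  exact (hr ℓ).2

/-- The `ℓ¹` distance of two product distributions is at most the sum of the distances of
their factors. -/
theorem sum_abs_prod_sub_prod_le {p q : ∀ ℓ, κ ℓ → ℝ} (hp : ∀ ℓ, p ℓ ∈ stdSimplex ℝ (κ ℓ))
    (hq : ∀ ℓ, q ℓ ∈ stdSimplex ℝ (κ ℓ)) :
    ∑ lam : (∀ ℓ, κ ℓ), |∏ ℓ, p ℓ (lam ℓ) - ∏ ℓ, q ℓ (lam ℓ)| ≤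
      ∑ ℓ, ∑ i, |p ℓ i - q ℓ i| := by
  -- Hybrid argument: the factors of `p` are replaced by those of `q` one at a time.
  have key : ∀ s : Finset L,
      ∑ lam : (∀ ℓ, κ ℓ), |∏ ℓ, p ℓ (lam ℓ) - ∏ ℓ, s.piecewise q p ℓ (lam ℓ)| ≤
        ∑ ℓ ∈ s, ∑ i, |p ℓ i - q ℓ i| := by
    intro s
    induction s using Finset.induction_on with
    | empty => simp
    | insert a s ha ih =>
      have hr : ∀ ℓ, s.piecewise q p ℓ ∈ stdSimplex ℝ (κ ℓ) := fun ℓ => by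
        by_cases h : ℓ ∈ s <;> simp [h, hp, hq]
      have h2 := sum_abs_prod_sub_prod_update hr a (q a)
      rw [Finset.piecewise_eq_of_notMem _ _ _ ha] at h2
      rw [Finset.piecewise_insert, Finset.sum_insert ha, ← h2, add_comm]
      refine le_trans ?_ (add_le_add_left ih _)
      rw [← Finset.sum_add_distrib]
      exact Finset.sum_le_sum fun lam _ => abs_sub_le _ _ _
  simpa using key Finset.univ

/-- Each `h lam` has total mass one, so mixing does not increase the `ℓ¹` distance of the weights.
-/
theorem distrDist_mixture_le [Fintype X] {p q : ∀ ℓ, κ ℓ → ℝ} {h : (∀ ℓ, κ ℓ) → X → ℝ}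
    (hp : ∀ ℓ, p ℓ ∈ stdSimplex ℝ (κ ℓ)) (hq : ∀ ℓ, q ℓ ∈ stdSimplex ℝ (κ ℓ))
    (hh : ∀ lam, h lam ∈ stdSimplex ℝ X) :
    distrDist (mixture p h) (mixture q h) ≤ ∑ ℓ, ∑ i, |p ℓ i - q ℓ i| := by
  refine le_trans ?_ (sum_abs_prod_sub_prod_le hp hq)
  have h1 : ∀ x, |mixture p h x - mixture q h x| ≤
      ∑ lam : (∀ ℓ, κ ℓ), |∏ ℓ, p ℓ (lam ℓ) - ∏ ℓ, q ℓ (lam ℓ)| * h lam x := by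
    intro x
    simp only [mixture]
    rw [← Finset.sum_sub_distrib]
    refine (Finset.abs_sum_le_sum_abs _ _).trans_eq (Finset.sum_congr rfl fun lam _ => ?_)
    rw [← sub_mul, abs_mul, abs_of_nonneg ((hh lam).1 x)]
  refine (Finset.sum_le_sum fun x _ => h1 x).trans_eq ?_
  rw [Finset.sum_comm]
  simp only [← Finset.mul_sum, (hh _).2, mul_one]

end Mixture

/-! ### Reduction of supports -/

/-- Carathéodory's theorem for a mixture of points of a simplex: at most as many of them as the
simplex has vertices are needed. -/
theorem exists_small_support {ι X : Type*} [Fintype ι] [DecidableEq ι] [Fintype X]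
    (A : ι → X → ℝ) (hA : ∀ i, A i ∈ stdSimplex ℝ X) {w : ι → ℝ} (hw : w ∈ stdSimplex ℝ ι) :
    ∃ w' ∈ stdSimplex ℝ ι, (Finset.univ.filter fun i => w' i ≠ 0).card ≤ Fintype.card X ∧
      ∑ i, w' i • A i = ∑ i, w i • A i := by
  have hmem : ∑ i, w i • A i ∈ convexHull ℝ (Set.range A) :=
    (convex_convexHull ℝ _).sum_mem (fun i _ => hw.1 i) hw.2
      fun i _ => subset_convexHull ℝ _ (Set.mem_range_self i)
  obtain ⟨τ, _, z, u, hz, hind, hu, hu1, hsum⟩ := eq_pos_convex_span_of_mem_convexHull hmem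
  choose a ha using fun j => hz (Set.mem_range_self j)
  -- Points of the simplex lie on the hyperplane of coordinate sum one, which misses the origin, so
  -- affine independence gives linear independence. This yields `card X` rather than `card X + 1`.
  have hlin : LinearIndependent ℝ z := by
    rw [linearIndependent_iff']
    intro s g hg
    refine affineIndependent_iff.1 hind s g ?_ hg
    have h1 : ∑ x, (∑ j ∈ s, g j • z j) x = ∑ j ∈ s, g j := by
      simp only [Finset.sum_apply, Pi.smul_apply, smul_eq_mul]
      rw [Finset.sum_comm]
      refine Finset.sum_congr rfl fun j _ => ?_
      rw [← Finset.mul_sum, ← ha j, (hA (a j)).2, mul_one]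
    rw [← h1, hg]
    simp
  have hcard : Fintype.card τ ≤ Fintype.card X := by
    simpa using hlin.fintype_card_le_finrank
  refine ⟨fun i => ∑ j with a j = i, u j,
    ⟨fun i => Finset.sum_nonneg fun j _ => (hu j).le, ?_⟩, ?_, ?_⟩
  · rw [Finset.sum_fiberwise, hu1]
  · refine le_trans (Finset.card_le_card (t := Finset.univ.image a) ?_)
      (Finset.card_image_le.trans hcard)
    intro i hi
    obtain ⟨j, hj, -⟩ := Finset.exists_ne_zero_of_sum_ne_zero (Finset.mem_filter.1 hi).2
    exact Finset.mem_image.2 ⟨j, Finset.mem_univ j, (Finset.mem_filter.1 hj).2⟩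
  · rw [← hsum, ← Finset.sum_fiberwise (s := Finset.univ) (g := a)]
    refine Finset.sum_congr rfl fun i _ => ?_
    rw [Finset.sum_smul]
    refine Finset.sum_congr rfl fun j hj => ?_
    rw [← ha j, (Finset.mem_filter.1 hj).2]

theorem mixture_exists_small_support {L X : Type*} [Fintype L] [DecidableEq L] {κ : L → Type*}
    [∀ ℓ, Fintype (κ ℓ)] [∀ ℓ, DecidableEq (κ ℓ)] [Fintype X] {p : ∀ ℓ, κ ℓ → ℝ}
    {h : (∀ ℓ, κ ℓ) → X → ℝ} (hp : ∀ ℓ, p ℓ ∈ stdSimplex ℝ (κ ℓ)) (hh : ∀ lam, h lam ∈ stdSimplex ℝ X) :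
    ∃ q : ∀ ℓ, κ ℓ → ℝ, (∀ ℓ, q ℓ ∈ stdSimplex ℝ (κ ℓ)) ∧
      (∀ ℓ, (Finset.univ.filter fun i => q ℓ i ≠ 0).card ≤ Fintype.card X) ∧
      mixture q h = mixture p h := by
  have key : ∀ s : Finset L, ∃ q : ∀ ℓ, κ ℓ → ℝ, (∀ ℓ, q ℓ ∈ stdSimplex ℝ (κ ℓ)) ∧
      (∀ ℓ ∈ s, (Finset.univ.filter fun i => q ℓ i ≠ 0).card ≤ Fintype.card X) ∧
      mixture q h = mixture p h := by
    intro s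
    induction s using Finset.induction_on with
    | empty => exact ⟨p, hp, by simp, rfl⟩
    | insert a s ha ih =>
      obtain ⟨q, hq, hqs, hqp⟩ := ih
      have hupd : ∀ w ∈ stdSimplex ℝ (κ a), ∀ ℓ,
          Function.update q a w ℓ ∈ stdSimplex ℝ (κ ℓ) := by
        intro w hw ℓ
        rcases eq_or_ne ℓ a with rfl | hℓ
        · simpa using hw
        · simpa [hℓ] using hq ℓ
      obtain ⟨w, hw, hwc, hwq⟩ := exists_small_support
        (fun i => mixture (Function.update q a (Pi.single i 1)) h)
        (fun i => mixture_mem_stdSimplex (hupd _ (single_mem_stdSimplex ℝ i)) hh) (hq a)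
      refine ⟨Function.update q a w, hupd w hw, ?_, ?_⟩
      · intro ℓ hℓ
        rcases eq_or_ne ℓ a with rfl | hne
        · simpa using hwc
        · simpa [hne] using hqs ℓ (Finset.mem_of_mem_insert_of_ne hℓ hne)
      · rw [mixture_update, hwq, ← mixture_update, Function.update_eq_self, hqp]
  simpa using key Finset.univ

/-! ### Approximation by uniform distributions -/

/-- Rounding the cumulative distribution function to multiples of `1 / k` approximates a
distribution on `d` points up to `(d - 1) / k` in `ℓ¹` distance. -/
theorem exists_rounding {d k : ℕ} (hk : 1 ≤ k) {p : Fin d → ℝ} (hp : p ∈ stdSimplex ℝ (Fin d)) :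
    ∃ m : Fin d → ℕ, ∑ i, m i = k ∧ ∑ i, |p i - m i / k| ≤ ((d : ℝ) - 1) / k := by
  have hk0 : (0 : ℝ) < k := by exact_mod_cast hk
  have hd : d ≠ 0 := by
    rintro rfl
    simpa using hp.2
  obtain ⟨e, rfl⟩ := Nat.exists_eq_succ_of_ne_zero hd
  -- `k` times the cumulative distribution; `m i` will be the increment of its rounding, so the sum
  -- telescopes to `k`.
  set F : ℕ → ℝ := fun n => ∑ i : Fin (e + 1) with i.1 < n, k * p i with hF
  have hFs : ∀ i : Fin (e + 1), F (i.1 + 1) = F i.1 + k * p i := by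
    intro i
    have h1 : (Finset.univ.filter fun j : Fin (e + 1) => j.1 < i.1 + 1) =
        insert i (Finset.univ.filter fun j : Fin (e + 1) => j.1 < i.1) := by
      ext j
      simp only [Finset.mem_filter, Finset.mem_univ, true_and, Finset.mem_insert, Fin.ext_iff]
      omega
    simp only [hF]
    rw [h1, Finset.sum_insert (by simp), add_comm]
  have hF0 : F 0 = 0 := by simp [hF]
  have hFd : F (e + 1) = k := by
    simp only [hF, Fin.is_lt, Finset.filter_true, ← Finset.mul_sum, hp.2, mul_one]
  have hmono : ∀ i : Fin (e + 1), round (F i.1) ≤ round (F (i.1 + 1)) := by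
    intro i
    rw [round_eq, round_eq]
    refine Int.floor_le_floor ?_
    rw [hFs i]
    have := mul_nonneg hk0.le (hp.1 i)
    linarith
  have hm : ∀ i : Fin (e + 1), (((round (F (i.1 + 1)) - round (F i.1)).toNat : ℕ) : ℤ) =
      round (F (i.1 + 1)) - round (F i.1) :=
    fun i => Int.toNat_of_nonneg (sub_nonneg.2 (hmono i))
  refine ⟨fun i => (round (F (i.1 + 1)) - round (F i.1)).toNat, ?_, ?_⟩
  · zify
    simp only [hm]
    rw [Fin.sum_univ_eq_sum_range (fun i => round (F (i + 1)) - round (F i)),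
      Finset.sum_range_sub (fun i => round (F i)), hF0, hFd]
    simp
  -- Each of the `d - 1` interior cut points errs by at most `1 / 2` and is counted in two
  -- increments; the end values `0` and `k` are integers and round exactly.
  · set err : ℕ → ℝ := fun n => |F n - round (F n)| with herr
    have h1 : ∀ i : Fin (e + 1),
        |p i - ((round (F (i.1 + 1)) - round (F i.1)).toNat : ℕ) / (k : ℝ)| ≤
          (err i.1 + err (i.1 + 1)) / k := by
      intro i
      have hmR : (((round (F (i.1 + 1)) - round (F i.1)).toNat : ℕ) : ℝ) =
          round (F (i.1 + 1)) - round (F i.1) := by exact_mod_cast congrArg (Int.cast (R := ℝ)) (hm i)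
      have h2 : p i - ((round (F (i.1 + 1)) - round (F i.1)).toNat : ℕ) / (k : ℝ) =
          ((F (i.1 + 1) - round (F (i.1 + 1))) - (F i.1 - round (F i.1))) / k := by
        rw [hmR, hFs i]
        field_simp
        ring
      rw [h2, abs_div, abs_of_pos hk0, add_comm (err i.1)]
      gcongr
      simp only [herr]
      rw [sub_eq_add_neg (F (i.1 + 1) - _), ← abs_neg (F i.1 - _)]
      exact abs_add_le _ _
    refine (Finset.sum_le_sum fun i _ => h1 i).trans ?_
    rw [← Finset.sum_div]
    gcongr
    rw [Finset.sum_add_distrib, Fin.sum_univ_eq_sum_range err,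
      Fin.sum_univ_eq_sum_range (fun i => err (i + 1)), Finset.sum_range_succ',
      Finset.sum_range_succ]
    have e0 : err 0 = 0 := by simp [herr, hF0]
    have e1 : err (e + 1) = 0 := by simp [herr, hFd]
    have e2 : ∑ i ∈ Finset.range e, err (i + 1) ≤ ∑ i ∈ Finset.range e, (1 / 2 : ℝ) :=
      Finset.sum_le_sum fun i _ => abs_sub_round _
    simp only [Finset.sum_const, Finset.card_range, nsmul_eq_mul] at e2
    push_cast
    linarith

/-- A map from `Fin k` to `Fin d` with prescribed fibre sizes. -/
theorem exists_map_card_fiber {d k : ℕ} (m : Fin d → ℕ) (hm : ∑ i, m i = k) :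
    ∃ g : Fin k → Fin d, ∀ i, (Finset.univ.filter fun j => g j = i).card = m i := by
  subst hm
  -- `Fin k` is cut into consecutive blocks of lengths `m i`, and each block is sent to its index.
  refine ⟨fun j => (finSigmaFinEquiv.symm j).1, fun i => ?_⟩
  rw [← Fintype.card_subtype, Fintype.card_congr
    (finSigmaFinEquiv.symm.subtypeEquiv (q := fun s => s.1 = i) fun j => Iff.rfl),
    Fintype.card_congr (Equiv.sigmaSubtype i)]
  simp

/-- A map from `Fin k` to `Fin d` under which the uniform distribution is close to `p`. -/
theorem exists_uniform_approx {d k : ℕ} (hk : 1 ≤ k) {p : Fin d → ℝ}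
    (hp : p ∈ stdSimplex ℝ (Fin d)) :
    ∃ g : Fin k → Fin d,
      ∑ i, |p i - ∑ j with g j = i, 1 / (k : ℝ)| ≤ ((d : ℝ) - 1) / k := by
  obtain ⟨m, hm, hle⟩ := exists_rounding hk hp
  obtain ⟨g, hg⟩ := exists_map_card_fiber m hm
  refine ⟨g, le_of_eq_of_le (Finset.sum_congr rfl fun i _ => ?_) hle⟩
  rw [Finset.sum_const, hg, nsmul_eq_mul, mul_one_div]

/-! ### Deterministic responses -/

/-- For functions of the parents in a causal structure, the indicator that the visible valuation
`x` is the response to the latent valuation `lam`. -/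
def response {V L : Type*} [Fintype V] {Ω : V → Type*} [∀ v, DecidableEq (Ω v)]
    (G : CausalStructure V L) {κ : L → Type*}
    (f : ∀ v : V, (∀ u : G.VPa v, Ω u.1) → (∀ ℓ : G.LPa v, κ ℓ.1) → Ω v)
    (lam : ∀ ℓ, κ ℓ) (x : ∀ v, Ω v) : ℝ :=
  ∏ v, if x v = f v (fun u => x u.1) (fun ℓ => lam ℓ.1) then 1 else 0

theorem CausalStructure.wellFounded {V L : Type*} [Finite V] (G : CausalStructure V L) :
    WellFounded fun u v : V => G.Edge (Sum.inl u) (Sum.inl v) := by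
  have h1 : ∀ u v : V, Relation.TransGen (fun u v : V => G.Edge (Sum.inl u) (Sum.inl v)) u v →
      Relation.TransGen G.Edge (Sum.inl u) (Sum.inl v) :=
    fun u v h => h.lift Sum.inl fun _ _ h => h
  have : Std.Irrefl (Relation.TransGen fun u v : V => G.Edge (Sum.inl u) (Sum.inl v)) :=
    ⟨fun v h => G.acyclic _ (h1 v v h)⟩
  exact Subrelation.wf
    (r := Relation.TransGen fun u v : V => G.Edge (Sum.inl u) (Sum.inl v))
    (fun h => Relation.TransGen.single h) (Finite.wellFounded_of_trans_of_irrefl _)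

/-- A latent valuation determines the visible valuation. -/
theorem existsUnique_response {V L : Type*} [Finite V] {Ω : V → Type*}
    {G : CausalStructure V L} {κ : L → Type*}
    (f : ∀ v : V, (∀ u : G.VPa v, Ω u.1) → (∀ ℓ : G.LPa v, κ ℓ.1) → Ω v) (lam : ∀ ℓ, κ ℓ) :
    ∃! x : ∀ v, Ω v, ∀ v, x v = f v (fun u => x u.1) (fun ℓ => lam ℓ.1) := by
  let x : ∀ v, Ω v := G.wellFounded.fix fun v ih =>
    f v (fun u => ih u.1 u.2) (fun ℓ => lam ℓ.1)
  refine ⟨x, fun v => G.wellFounded.fix_eq _ v, fun y hy => funext fun v => ?_⟩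
  induction v using G.wellFounded.induction with
  | _ v ih =>
    rw [hy v, show x v = f v (fun u => x u.1) (fun ℓ => lam ℓ.1) from G.wellFounded.fix_eq _ v]
    congr 1
    exact funext fun u => ih u.1 u.2

/-- The response is the point mass at the unique solution of the structural equations. -/
theorem response_mem_stdSimplex {V L : Type*} [Fintype V] [DecidableEq V] {Ω : V → Type*}
    [∀ v, Fintype (Ω v)] [∀ v, DecidableEq (Ω v)] {G : CausalStructure V L} {κ : L → Type*}
    (f : ∀ v : V, (∀ u : G.VPa v, Ω u.1) → (∀ ℓ : G.LPa v, κ ℓ.1) → Ω v) (lam : ∀ ℓ, κ ℓ) :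
    response G f lam ∈ stdSimplex ℝ (∀ v, Ω v) := by
  obtain ⟨x, hx, hu⟩ := existsUnique_response f lam
  have h1 : ∀ y, response G f lam y = if y = x then 1 else 0 := by
    intro y
    simp only [response, Fintype.prod_boole]
    refine if_congr ⟨hu y, ?_⟩ rfl rfl
    rintro rfl
    exact hx
  refine ⟨fun y => ?_, by simp [h1]⟩
  rw [h1]
  split_ifs <;> norm_num

theorem FunctionalModel.one_le {V L : Type*} {Ω : V → Type*}
    {G : CausalStructure V L} {k : L → ℕ} (M : FunctionalModel G Ω k) (ℓ : L) : 1 ≤ k ℓ := by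
  by_contra h
  have hk : k ℓ = 0 := by omega
  have : IsEmpty (Fin (k ℓ)) := by rw [hk]; infer_instance
  simpa using (M.p_mem ℓ).2

/-! ### Compatible and uniformly induced distributions -/

section Model

variable {V L : Type*} [Fintype V] [Fintype L] [DecidableEq L] {Ω : V → Type*}
  [∀ v, DecidableEq (Ω v)] {G : CausalStructure V L} {k : L → ℕ}

theorem FunctionalModel.dist_eq_mixture (M : FunctionalModel G Ω k) :
    M.dist = mixture M.p (response G M.f) := rfl

theorem compatible_nonempty [∀ v, Nonempty (Ω v)] : (G.compatible Ω).Nonempty :=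
  ⟨_, fun _ => 1, ⟨fun v _ _ => Classical.arbitrary (Ω v), fun _ => Pi.single 0 1,
    fun _ => single_mem_stdSimplex ℝ 0⟩, rfl⟩

theorem CausalStructure.IsLatentBound.one_le [∀ v, Nonempty (Ω v)] {c : L → ℕ}
    (hc : G.IsLatentBound Ω c) (ℓ : L) : 1 ≤ c ℓ := by
  obtain ⟨P, hP⟩ := compatible_nonempty (G := G) (Ω := Ω)
  obtain ⟨k, hk, M, -⟩ := hc P hP
  exact (M.one_le ℓ).trans (hk ℓ)

theorem CausalStructure.IsLatentBound.one_le_sup [∀ v, Nonempty (Ω v)] {c : L → ℕ}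
    (hc : G.IsLatentBound Ω c) : Fintype.card L ≠ 0 → 1 ≤ Finset.univ.sup c := by
  intro hL
  obtain ⟨ℓ⟩ := Fintype.card_pos_iff.1 (Nat.pos_of_ne_zero hL)
  exact (hc.one_le ℓ).trans (Finset.le_sup (Finset.mem_univ ℓ))

variable [∀ v, Fintype (Ω v)]

/-- The bound leaves finitely many cardinalities `k` and, for each, finitely many `f`; for fixed `k`
and `f` the mixture is continuous on a product of simplices. -/
theorem CausalStructure.IsLatentBound.isCompact_compatible {c : L → ℕ}
    (hc : G.IsLatentBound Ω c) : IsCompact (G.compatible Ω) := by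
  have h1 : G.compatible Ω = ⋃ k ∈ Set.Iic c,
      ⋃ f : ∀ v : V, (∀ u : G.VPa v, Ω u.1) → (∀ ℓ : G.LPa v, Fin (k ℓ.1)) → Ω v,
        (fun p : ∀ ℓ, Fin (k ℓ) → ℝ => mixture p (response G f)) ''
          Set.univ.pi fun ℓ => stdSimplex ℝ (Fin (k ℓ)) := by
    ext P
    simp only [Set.mem_iUnion, Set.mem_image, Set.mem_univ_pi]
    constructor
    · intro hP
      obtain ⟨k, hk, M, hM⟩ := hc P hP
      exact ⟨k, hk, M.f, M.p, M.p_mem, hM⟩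
    · rintro ⟨k, -, f, p, hp, hP⟩
      exact ⟨k, ⟨f, p, hp⟩, hP⟩
  rw [h1]
  refine (Set.finite_Iic c).isCompact_biUnion fun k _ => isCompact_iUnion fun f => ?_
  refine (isCompact_univ_pi fun ℓ => isCompact_stdSimplex ℝ _).image ?_
  unfold mixture
  fun_prop

theorem finite_uniformlyInduced (k : L → ℕ) : (G.uniformlyInduced Ω k).Finite := by
  refine (Set.finite_range fun f : (∀ v : V, (∀ u : G.VPa v, Ω u.1) →
    (∀ ℓ : G.LPa v, Fin (k ℓ.1)) → Ω v) =>
      mixture (fun ℓ _ => 1 / (k ℓ : ℝ)) (response G (κ := fun ℓ => Fin (k ℓ)) f)).subset ?_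
  rintro P ⟨M, hM, rfl⟩
  refine ⟨M.f, ?_⟩
  rw [M.dist_eq_mixture, show M.p = fun ℓ _ => 1 / (k ℓ : ℝ) from
    funext fun ℓ => funext fun i => hM ℓ i]

variable [DecidableEq V]

/-- After the supports are shrunk, each latent is relabelled by its support, and the inclusions `g`
are composed into the functions of the model. -/
theorem CausalStructure.isLatentBound_card (G : CausalStructure V L) :
    G.IsLatentBound Ω fun _ => Fintype.card (∀ v, Ω v) := by
  rintro P ⟨k, M, rfl⟩
  obtain ⟨q, hq, hcard, hqp⟩ :=
    mixture_exists_small_support M.p_mem (response_mem_stdSimplex M.f)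
  let e : ∀ ℓ, {i : Fin (k ℓ) // q ℓ i ≠ 0} ≃ Fin (Fintype.card {i : Fin (k ℓ) // q ℓ i ≠ 0}) :=
    fun ℓ => Fintype.equivFin _
  let g : ∀ ℓ, Fin (Fintype.card {i : Fin (k ℓ) // q ℓ i ≠ 0}) → Fin (k ℓ) :=
    fun ℓ j => ((e ℓ).symm j).1
  have hg : ∀ ℓ, Function.Injective (g ℓ) :=
    fun ℓ => Subtype.val_injective.comp (e ℓ).symm.injective
  have hpush : ∀ ℓ i, ∑ j with g ℓ j = i, q ℓ (g ℓ j) = q ℓ i := by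
    intro ℓ i
    by_cases hi : q ℓ i = 0
    · rw [hi]
      exact Finset.sum_eq_zero fun j hj => by rw [(Finset.mem_filter.1 hj).2, hi]
    · have h1 : g ℓ (e ℓ ⟨i, hi⟩) = i := by simp [g]
      rw [Finset.sum_eq_single_of_mem (e ℓ ⟨i, hi⟩) (by simp [h1]), h1]
      intro j hj hne
      exact absurd (hg ℓ ((Finset.mem_filter.1 hj).2.trans h1.symm)) hne
  refine ⟨fun ℓ => Fintype.card {i : Fin (k ℓ) // q ℓ i ≠ 0}, fun ℓ => ?_,
    ⟨fun v xs ls => M.f v xs fun ℓ => g ℓ.1 (ls ℓ), fun ℓ j => q ℓ (g ℓ j),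
      fun ℓ => ⟨fun j => (hq ℓ).1 _, ?_⟩⟩, ?_⟩
  · exact (Fintype.card_subtype _).trans_le (hcard ℓ)
  · rw [← Finset.sum_fiberwise (s := Finset.univ) (g := g ℓ)]
    simp only [hpush]
    exact (hq ℓ).2
  · refine (mixture_comp g (fun ℓ j => q ℓ (g ℓ j)) (response G M.f)).trans ?_
    simp only [hpush]
    exact hqp

/-- Every functional model is approximated by uniform ones of given larger cardinalities. -/
theorem FunctionalModel.exists_uniform_approx (M : FunctionalModel G Ω k) {k' : L → ℕ}
    (hk' : ∀ ℓ, 1 ≤ k' ℓ) :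
    ∃ Q ∈ G.uniformlyInduced Ω k', distrDist M.dist Q ≤ ∑ ℓ, ((k ℓ : ℝ) - 1) / k' ℓ := by
  choose g hg using fun ℓ => _root_.exists_uniform_approx (hk' ℓ) (M.p_mem ℓ)
  have hunif : ∀ ℓ, (fun _ => 1 / (k' ℓ : ℝ)) ∈ stdSimplex ℝ (Fin (k' ℓ)) := by
    intro ℓ
    have : (k' ℓ : ℝ) ≠ 0 := Nat.cast_ne_zero.2 (Nat.one_le_iff_ne_zero.1 (hk' ℓ))
    exact ⟨fun _ => by positivity, by simp [this]⟩
  set q : ∀ ℓ, Fin (k ℓ) → ℝ := fun ℓ i => ∑ j with g ℓ j = i, 1 / (k' ℓ : ℝ)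
  have hq : ∀ ℓ, q ℓ ∈ stdSimplex ℝ (Fin (k ℓ)) := fun ℓ =>
    ⟨fun i => Finset.sum_nonneg fun j _ => (hunif ℓ).1 j,
      (Finset.sum_fiberwise _ _ _).trans (hunif ℓ).2⟩
  -- Coarse-graining uniform latents by `g` inside the functions has the same effect as giving the
  -- latents of `M` the weights `q`.
  let N : FunctionalModel G Ω k' :=
    ⟨fun v xs ls => M.f v xs fun ℓ => g ℓ.1 (ls ℓ), fun ℓ _ => 1 / (k' ℓ : ℝ), hunif⟩
  have hN : N.dist = mixture q (response G M.f) :=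
    mixture_comp g (fun ℓ _ => 1 / (k' ℓ : ℝ)) (response G M.f)
  refine ⟨N.dist, ⟨N, fun _ _ => rfl, rfl⟩, ?_⟩
  rw [hN, dist_eq_mixture]
  have hle := distrDist_mixture_le M.p_mem hq (response_mem_stdSimplex M.f)
  exact hle.trans (Finset.sum_le_sum fun ℓ _ => hg ℓ)

theorem uniformlyInduced_nonempty [∀ v, Nonempty (Ω v)] (hk : ∀ ℓ, 1 ≤ k ℓ) :
    (G.uniformlyInduced Ω k).Nonempty := by
  obtain ⟨P, k', M, rfl⟩ := compatible_nonempty (G := G) (Ω := Ω)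
  obtain ⟨Q, hQ, -⟩ := M.exists_uniform_approx hk
  exact ⟨Q, hQ⟩

end Model

/-! ### The error term -/

section ErrorBound

theorem errorBound_base_nonneg {L C : ℕ} (hC : L ≠ 0 → 1 ≤ C) (K : ℕ) :
    0 ≤ (L : ℝ) * ((C : ℝ) - 1) / (K : ℝ) := by
  rcases eq_or_ne L 0 with rfl | hL
  · simp
  · have : (1 : ℝ) ≤ C := by exact_mod_cast hC hL
    have : (0 : ℝ) ≤ (C : ℝ) - 1 := by linarith
    positivity

theorem errorBound_antitone {L C : ℕ} (hC : L ≠ 0 → 1 ≤ C) {K K' : ℕ} (hK : 1 ≤ K)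
    (hKK' : K ≤ K') : errorBound L C K' ≤ errorBound L C K := by
  have h0 := errorBound_base_nonneg hC 1
  have h1 := errorBound_base_nonneg hC K'
  rw [Nat.cast_one, div_one] at h0
  have hK0 : (0 : ℝ) < K := by exact_mod_cast hK
  refine Finset.sum_le_sum fun n _ => ?_
  gcongr

theorem tendsto_errorBound (L C : ℕ) :
    Filter.Tendsto (fun K : ℕ => errorBound L C K) Filter.atTop (𝓝 0) := by
  have h1 := tendsto_const_div_atTop_nhds_zero_nat ((L : ℝ) * ((C : ℝ) - 1))
  have h2 : Filter.Tendsto (fun K : ℕ => errorBound L C K) Filter.atTop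
      (𝓝 (∑ n ∈ Finset.Icc 1 L, (1 / (n ! : ℝ)) * (0 : ℝ) ^ n)) :=
    tendsto_finsetSum _ fun n _ => (h1.pow n).const_mul _
  convert h2 using 2
  refine (Finset.sum_eq_zero fun n hn => ?_).symm
  rw [zero_pow (by have := (Finset.mem_Icc.1 hn).1; omega), mul_zero]

theorem errorBound_le {L C : ℕ} (hC : L ≠ 0 → 1 ≤ C) {K : ℕ} (hK : 1 ≤ K) (hLC : L * C ≤ K) :
    errorBound L C K ≤ 2 * ((L : ℝ) * (C : ℝ) / (K : ℝ)) := by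
  have hK0 : (0 : ℝ) < K := by exact_mod_cast hK
  have h0 := errorBound_base_nonneg hC K
  set y := (L : ℝ) * ((C : ℝ) - 1) / (K : ℝ) with hy
  have h1 : y ≤ (L : ℝ) * (C : ℝ) / (K : ℝ) := by
    rw [hy]
    gcongr
    linarith
  have h2 : (L : ℝ) * (C : ℝ) / (K : ℝ) ≤ 1 := by
    rw [div_le_one hK0]
    exact_mod_cast hLC
  -- Adding the term `n = 0` turns the error into a partial sum of the exponential series; then
  -- `|exp y - 1| ≤ 2|y|` for `|y| ≤ 1`.
  have h3 : errorBound L C K + 1 ≤ Real.exp y := by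
    refine le_of_eq_of_le ?_ (Real.sum_le_exp_of_nonneg h0 (L + 1))
    rw [Finset.sum_range_succ', errorBound, Finset.range_eq_Ico,
      Finset.sum_Ico_add' (fun n => y ^ n / (n ! : ℝ)) 0 L 1]
    simp only [Nat.factorial_zero, pow_zero, Nat.cast_one, div_one, zero_add]
    congr 1
    exact Finset.sum_congr rfl fun n _ => by rw [one_div_mul_eq_div]
  have h4 := Real.abs_exp_sub_one_le (x := y) (by rw [abs_of_nonneg h0]; linarith)
  rw [abs_of_nonneg h0] at h4
  have h5 := le_abs_self (Real.exp y - 1)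
  linarith

theorem le_errorBound {L C : ℕ} (hC : L ≠ 0 → 1 ≤ C) (K : ℕ) :
    (L : ℝ) * ((C : ℝ) - 1) / (K : ℝ) ≤ errorBound L C K := by
  have h0 := errorBound_base_nonneg hC K
  rcases eq_or_ne L 0 with rfl | hL
  · simp [errorBound]
  · refine le_of_eq_of_le ?_ (Finset.single_le_sum
      (f := fun n => (1 / (n ! : ℝ)) * ((L : ℝ) * ((C : ℝ) - 1) / (K : ℝ)) ^ n)
      (fun n _ => by positivity) (Finset.mem_Icc.2 ⟨le_rfl, Nat.one_le_iff_ne_zero.2 hL⟩))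
    simp

end ErrorBound

/-! ### Soundness and completeness of the test -/

theorem dist_le_distrDist {X : Type*} [Fintype X] (P Q : X → ℝ) : dist P Q ≤ distrDist P Q := by
  refine (dist_pi_le_iff (Finset.sum_nonneg fun _ _ => abs_nonneg _)).2 fun x => ?_
  rw [Real.dist_eq]
  exact Finset.single_le_sum (f := fun x => |P x - Q x|) (fun _ _ => abs_nonneg _)
    (Finset.mem_univ x)

section Test

variable {V L : Type*} [Fintype V] [DecidableEq V] [Fintype L] [DecidableEq L] {Ω : V → Type*}
  [∀ v, Fintype (Ω v)] [∀ v, DecidableEq (Ω v)] {G : CausalStructure V L}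
  {c : L → ℕ} {P : (∀ v, Ω v) → ℝ}

theorem passesTest_of_compatible [∀ v, Nonempty (Ω v)] (hc : G.IsLatentBound Ω c)
    (hP : P ∈ G.compatible Ω) {K : ℕ} {k : L → ℕ} (hK : 1 ≤ K) (hk : ∀ ℓ, K ≤ k ℓ) :
    PassesTest G c K k P := by
  obtain ⟨k₀, hk₀, M, rfl⟩ := hc P hP
  obtain ⟨Q, hQ, hle⟩ := M.exists_uniform_approx fun ℓ => hK.trans (hk ℓ)
  refine ⟨Q, hQ, hle.trans (le_trans ?_ (le_errorBound hc.one_le_sup K))⟩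
  have hK0 : (0 : ℝ) < K := by exact_mod_cast hK
  have h1 : ∀ ℓ, ((k₀ ℓ : ℝ) - 1) / k ℓ ≤ (((Finset.univ.sup c : ℕ) : ℝ) - 1) / K := by
    intro ℓ
    have ha : (k₀ ℓ : ℝ) ≤ (Finset.univ.sup c : ℕ) := by
      exact_mod_cast (hk₀ ℓ).trans (Finset.le_sup (Finset.mem_univ ℓ))
    have hb : (1 : ℝ) ≤ k₀ ℓ := by exact_mod_cast M.one_le ℓ
    have hd : (K : ℝ) ≤ k ℓ := by exact_mod_cast hk ℓ
    exact div_le_div₀ (by linarith) (by linarith) hK0 hd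
  refine (Finset.sum_le_sum fun ℓ _ => h1 ℓ).trans_eq ?_
  rw [Finset.sum_const, nsmul_eq_mul, Finset.card_univ, mul_div_assoc]

/-- A ball around `P` misses the closed compatible set; once `ε(K)` is below its radius, a passing
`Q`, being compatible, would lie in it. -/
theorem exists_not_passesTest (hc : G.IsLatentBound Ω c) (hP : P ∉ G.compatible Ω) :
    ∃ K₀ : ℕ, 1 ≤ K₀ ∧ ∀ (K : ℕ) (k : L → ℕ), K₀ ≤ K → ¬ PassesTest G c K k P := by
  obtain ⟨r, hr, hball⟩ :=
    Metric.isOpen_iff.1 hc.isCompact_compatible.isClosed.isOpen_compl P hP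
  obtain ⟨N, hN⟩ := Filter.eventually_atTop.1
    ((tendsto_errorBound (Fintype.card L) (Finset.univ.sup c)).eventually_lt_const hr)
  refine ⟨max 1 N, le_max_left _ _, fun K k hK ⟨Q, ⟨M, _, hM⟩, hle⟩ => ?_⟩
  have h1 : dist P Q < r :=
    (dist_le_distrDist P Q).trans_lt (hle.trans_lt (hN K ((le_max_right _ _).trans hK)))
  exact hball (by rwa [Metric.mem_ball, dist_comm]) ⟨k, M, hM⟩

theorem exists_best_uniform [∀ v, Nonempty (Ω v)] {k : L → ℕ} (hk : ∀ ℓ, 1 ≤ k ℓ)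
    (P : (∀ v, Ω v) → ℝ) :
    ∃ M : FunctionalModel G Ω k, M.IsUniform ∧
      ∀ Q ∈ G.uniformlyInduced Ω k, distrDist P M.dist ≤ distrDist P Q := by
  obtain ⟨Q, ⟨M, hM, rfl⟩, hmin⟩ := Set.exists_min_image (G.uniformlyInduced Ω k)
    (distrDist P) (finite_uniformlyInduced k) (uniformlyInduced_nonempty hk)
  exact ⟨M, hM, hmin⟩

end Test

theorem mainTheorem1 {V L : Type*} [Fintype V] [DecidableEq V] [Fintype L] [DecidableEq L]
    (Ω : V → Type*) [∀ v, Fintype (Ω v)] [∀ v, DecidableEq (Ω v)] [∀ v, Nonempty (Ω v)]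
    (G : CausalStructure V L) :
    -- finite bounds on the latent cardinalities exist, e.g. the number of visible valuations
    G.IsLatentBound Ω (fun _ => Fintype.card (∀ v, Ω v)) ∧
    -- with any such bounds (in particular the smallest ones):
    ∀ c : L → ℕ, G.IsLatentBound Ω c →
      -- `ε(K) ∈ O(LC/K)`, `ε(K) → 0`, and `ε(K)` decreases with `K`
      (∀ K : ℕ, 1 ≤ K → Fintype.card L * Finset.univ.sup c ≤ K →
        testError c K ≤
          2 * ((Fintype.card L : ℝ) * ((Finset.univ.sup c : ℕ) : ℝ) / (K : ℝ))) ∧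
      Filter.Tendsto (fun K : ℕ => testError c K) Filter.atTop (𝓝 0) ∧
      (∀ K K' : ℕ, 1 ≤ K → K ≤ K' → testError c K' ≤ testError c K) ∧
      ∀ P ∈ stdSimplex ℝ (∀ v, Ω v),
        -- compatible distributions pass at every order
        (P ∈ G.compatible Ω →
          ∀ (K : ℕ) (k : L → ℕ), 1 ≤ K → (∀ ℓ, K ≤ k ℓ) → PassesTest G c K k P) ∧
        -- incompatible distributions fail at every sufficiently large finite order
        (P ∉ G.compatible Ω →
          ∃ K₀ : ℕ, 1 ≤ K₀ ∧ ∀ (K : ℕ) (k : L → ℕ), K₀ ≤ K → (∀ ℓ, K ≤ k ℓ) →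
            ¬ PassesTest G c K k P) ∧
        -- the hierarchy is exact in the limit
        (P ∈ G.compatible Ω ↔
          ∀ K : ℕ, 1 ≤ K → ∃ k : L → ℕ, (∀ ℓ, K ≤ k ℓ) ∧ PassesTest G c K k P) ∧
        -- each test is a search over finitely many distributions, and a uniform functional model
        -- generating a best approximation exists and decides the test
        (∀ k : L → ℕ, (∀ ℓ, 1 ≤ k ℓ) →
          (G.uniformlyInduced Ω k).Finite ∧
          ∃ M : FunctionalModel G Ω k, M.IsUniform ∧
            (∀ Q ∈ G.uniformlyInduced Ω k, distrDist P M.dist ≤ distrDist P Q) ∧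
            ∀ K : ℕ, 1 ≤ K → (∀ ℓ, K ≤ k ℓ) →
              (PassesTest G c K k P ↔ distrDist P M.dist ≤ testError c K)) := by
  refine ⟨G.isLatentBound_card, fun c hc => ⟨fun K hK hLC => errorBound_le hc.one_le_sup hK hLC,
    tendsto_errorBound _ _, fun K K' => errorBound_antitone hc.one_le_sup, fun P _ => ?_⟩⟩
  have pass : P ∈ G.compatible Ω →
      ∀ (K : ℕ) (k : L → ℕ), 1 ≤ K → (∀ ℓ, K ≤ k ℓ) → PassesTest G c K k P :=
    fun hP K k => passesTest_of_compatible hc hP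
  refine ⟨pass, fun hP => ?_, ⟨fun hP K hK => ⟨fun _ => K, fun _ => le_rfl,
    pass hP K _ hK fun _ => le_rfl⟩, fun h => ?_⟩, fun k hk => ⟨finite_uniformlyInduced k, ?_⟩⟩
  · obtain ⟨K₀, hK₀, hfail⟩ := exists_not_passesTest hc hP
    exact ⟨K₀, hK₀, fun K k hK _ => hfail K k hK⟩
  · by_contra hP
    obtain ⟨K₀, hK₀, hfail⟩ := exists_not_passesTest hc hP
    obtain ⟨k, -, hk⟩ := h K₀ hK₀
    exact hfail K₀ k le_rfl hk
  · obtain ⟨M, hM, hmin⟩ := exists_best_uniform (G := G) hk P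
    exact ⟨M, hM, hmin, fun K _ _ => ⟨fun ⟨Q, hQ, hle⟩ => (hmin Q hQ).trans hle,
      fun hle => ⟨M.dist, ⟨M, hM, rfl⟩, hle⟩⟩⟩
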